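/- Binomial coefficients $\binom ab$ of integers are $0$ unless $0\le b\le a$. A composition of $m$ into $h$ parts is a sequence of $h$ positive integers with sum $m$, drawn as a tableau whose rows have the parts as lengths; let $M^h_m$ be their number. Deleting the first $r$ columns replaces each row length $a$ by $\max(a-r,0)$, empty rows being dropped; the weight of what remains is its number of cells. For $s\ge 0$ put $$c^{(s)mg}_h=\frac1g\sum_{k=1}^{g}\ \sum_{f_1,\dots,f_s} k\binom h{f_1}\binom{f_1}{f_2}\cdots\binom{f_{s-1}}{f_s}\binom{f_s}{k}\binom gk\quad(g\neq0),\qquad c^{(s)m0}_h=\sum_{f_1,\dots,f_s}\binom h{f_1}\binom{f_1}{f_2}\cdots\binom{f_{s-1}}{f_s},$$ where the inner sums run over integers $h\ge f_1\ge\dots\ge f_s\ge k$ (with $k=0$ in the second formula) such that $f_1+\dots+f_s=m-h-g$; for $s=0$ read $f_0=h$ (the sum has one term, $k\binom hk\binom gk$ respectively $1$, if $m=h+g$, and is empty otherwise). For $m,n\ge1$, $N=m+n$ and a binary string $U$, let $T^{mn}_g(U)$ be the number of binary sequences of length $N$ with $m$ zeros and $n$ ones in which $U$ occurs starting at exactly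 $g$ of the $N$ positions, the sequence being read cyclically. Then: 1. For all $s,m,g,h\ge0$, the number of compositions of $m$ into $h$ parts that leave weight $g$ after deletion of the first $s+1$ columns is $c^{(s)mg}_h$ (equal remainders of different compositions are counted separately). For $1\le h\le m$ the weights that occur are exactly the integers $g$ with $\max(0,m-(s+1)h)\le g\le\max(0,m-h-s)$. 2. (One column.) For $m\ge1$ and $g\ge 0$, the number of compositions of $m$, with any number of parts, that leave weight $g$ after deletion of the first column is $c^{mg}=\binom{m-1}g$. (Only compositions into $h=m-g$ parts contribute: for fixed $h$ the number is $\binom{m-1}g$ if $h=m-g$ and $0$ otherwise.) For $m,n\ge1$, $$T^{mn}_g(00)=\frac N{m-g}\,c^{mg}M^{m-g}_n\quad(0\le g<m),\qquad T^{mn}_g(11)=\frac N{n-g}\,c^{ng}M^{n-g}_m\quad(0\le g<n).$$ 3. For all $s,g\ge0$ and $m,n\ge1$, $$T^{mn}_g(0^{s+2})=\sum_{h=1}^m\frac Nh c^{(s)mg}_hM^h_n=\frac Nn\sum_{h=1}^m c^{(s)mg}_h\binom nh,\qquad T^{mn}_g(1^{s+2})=\sum_{h=1}^n\frac Nh c^{(s)ng}_hM^h_m=\frac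 Nm\sum_{h=1}^n c^{(s)ng}_h\binom mh.$$ 4. (Two columns.) For all $m,g,h\ge0$, $c^{(1)mg}_h=c'^{\,mg}_h$, where, for $g\ne0$, $$c'^{\,mg}_h=\frac1g\sum_{\ell=0}^{\max(0,\min(h,g,m-h-g))}\ell\binom h\ell\binom g\ell\binom{h-\ell}{m-g-h-\ell},$$ and $c'^{\,m0}_h=\binom h{m-h}$ if $m\le 2h$, $c'^{\,m0}_h=0$ if $m>2h$. Hence for $m,n\ge1$ and $g\ge0$, $$T^{mn}_g(000)=\sum_{h=1}^m\frac Nh c'^{\,mg}_hM^h_n=\frac Nn\sum_{h=1}^m c'^{\,mg}_h\binom nh,$$ and explicitly $$T^{mn}_g(000)=\frac N{ng}\sum_{h=1}^m\sum_{\ell=1}^g\ell\binom n\ell\binom g\ell\binom{n-\ell}{m-h-g-\ell}\binom{n-m+h+g}{2h+g-m}\quad(g\ge1),$$ $$T^{mn}_0(000)=\frac Nn\sum_{h=1}^m\binom h{m-h}\binom nh=\frac Nn\sum_{h=1}^m\binom n{m-h}\binom{n-m+h}{2h-m}.$$ -/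

import Mathlib

namespace BinSeq

/-- The binomial coefficient of two integers, with the convention that it vanishes
unless `0 ≤ b ≤ a`. -/
def binom (a b : ℤ) : ℚ :=
  if 0 ≤ b ∧ b ≤ a then (Nat.choose a.toNat b.toNat : ℚ) else 0

/-- The number of compositions (partitions regarding the order) of `n` into `h` parts. -/
def deMoivre (n h : ℕ) : ℕ :=
  (Finset.univ.filter fun p : Composition n => p.length = h).card

/-- The rows that remain after deleting the first `r` columns of the Young-De Moivre tableau
of the composition `p`: a row of length `a` keeps `a - r` cells, and disappears if `a ≤ r`. -/
def deleteColumns (r : ℕ) {m : ℕ} (p : Composition m) : List ℕ :=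
  (p.blocks.map fun a => a - r).filter fun a => 0 < a

/-- The weight (number of cells) of what remains after deleting the first `r` columns. -/
def remWeight (r : ℕ) {m : ℕ} (p : Composition m) : ℕ :=
  (deleteColumns r p).sum

/-- The number of tableaux of weight `m` and dimension `h` (compositions of `m` into `h` parts)
which leave a tableau of weight `g` after deletion of the first `s + 1` columns. Equal remaining
tableaux that come from different original tableaux are counted separately. -/
def remCount (s m g h : ℕ) : ℕ :=
  (Finset.univ.filter fun p : Composition m => p.length = h ∧ remWeight (s + 1) p = g).card

/-- The chains `j ≥ f₁ ≥ f₂ ≥ ⋯ ≥ f_s ≥ k` with `f₁ + ⋯ + f_s = i - j - g`. -/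
def chains (s i g j k : ℕ) : Finset (Fin s → ℕ) :=
  (Fintype.piFinset fun _ : Fin s => Finset.Icc k j).filter fun f =>
    (∀ a b : Fin s, a ≤ b → f b ≤ f a) ∧ (∑ a, f a) + j + g = i

/-- The product of the binomial coefficients `C(F₀, F₁) C(F₁, F₂) ⋯ C(F_{r-1}, F_r)`. -/
def chainProd {r : ℕ} (F : Fin (r + 1) → ℕ) : ℕ :=
  ∏ a : Fin r, Nat.choose (F a.castSucc) (F a.succ)

/-- The coefficient `c^{(s) i g}_j`. For `g ≠ 0` it is
`(1/g) ∑_{k=1}^g ∑_f k C(j,f₁) C(f₁,f₂) ⋯ C(f_{s-1},f_s) C(f_s,k) C(g,k)`,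
and for `g = 0` it is `∑_f C(j,f₁) C(f₁,f₂) ⋯ C(f_{s-1},f_s)`, where `f` runs over the chains
with `f₁ + ⋯ + f_s = i - j - g` (and `f₀ = j`, so that the formula makes sense for `s = 0`). -/
def c (s i g j : ℕ) : ℚ :=
  if g = 0 then
    ∑ f ∈ chains s i 0 j 0, (chainProd (Fin.cons j f : Fin (s + 1) → ℕ) : ℚ)
  else
    (1 / (g : ℚ)) * ∑ k ∈ Finset.Icc 1 g, ∑ f ∈ chains s i g j k,
      (k : ℚ) *
        (chainProd (Fin.cons j (Fin.snoc f k : Fin (s + 1) → ℕ) : Fin (s + 2) → ℕ) : ℚ) *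
        (Nat.choose g k : ℚ)

/-- The coefficient `c'^{m g}_h`, for two deleted columns, in explicit form. -/
def cPrime (m g h : ℕ) : ℚ :=
  if g = 0 then
    (if m ≤ 2 * h then binom h ((m : ℤ) - h) else 0)
  else
    (1 / (g : ℚ)) * ∑ l ∈ Finset.range (min h (min g (m - h - g)) + 1),
      (l : ℚ) * (Nat.choose h l : ℚ) * (Nat.choose g l : ℚ) *
        binom ((h : ℤ) - l) ((m : ℤ) - g - h - l)

/-- The number of places (out of `N`) at which the string `U` occurs in the sequence `α` of
length `N`, the first digit being regarded as following the last one. -/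
def occ {N : ℕ} (U : List (Fin 2)) (α : Fin N → Fin 2) : ℕ :=
  (Finset.univ.filter fun i : Fin N =>
    ∀ j : Fin U.length, α ⟨(i.val + j.val) % N, Nat.mod_lt _ i.pos⟩ = U.get j).card

/-- `T m n U g` is the number of sequences of `m` zeros and `n` ones in which the string `U`
occurs, in the cyclic sense, exactly `g` times. -/
def T (m n : ℕ) (U : List (Fin 2)) (g : ℕ) : ℕ :=
  (Finset.univ.filter fun α : Fin (m + n) → Fin 2 =>
    (Finset.univ.filter fun i => α i = 0).card = m ∧
    (Finset.univ.filter fun i => α i = 1).card = n ∧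
    occ U α = g).card

end BinSeq

namespace BinSeq

/-! Cut a cyclic sequence at a one: it becomes a list of `n` run lengths of zeros, possibly 0, with
sum `m`. A run of length `a` contains `a - (s + 1)` occurrences (truncated subtraction) of
`0^(s+2)`, which is what deleting `s + 1` columns leaves of a row of length `a`. Counting pairs
(sequence, position of a one) and using rotation invariance gives `n * T = (m + n) * #lists`
(`mul_card_seqs`, `card_filter_seqs`). Choosing which `h` runs are nonempty turns the lists into
compositions, with weight `C(n, h)` (`coeff_one_add_rowSeries_pow_eq_sum`).

It remains to count compositions by surviving weight. The generating functions of one row satisfy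
`R_{r+1} = X (1 + R_r)`, so taking the `h`-th power gives a recursion that strips one column
(`remNum_succ`). The chain sums obey the same recursion when `f₁` is stripped (`c_succ`), and the
base cases agree (`c_zero_left`) because `k C(g, k) = g M^k_g`. That identity also converts `C(n, h)
/ n` into `M^h_n / h`. For two columns the single chain entry is forced, and the explicit formulas
follow from `C(n, k) C(k, l) = C(n, l) C(n - l, k - l)`. -/

section Auxiliary

open Finset

/-! ### Lists with given sum, powers of power series, and compositions -/

section Lists

/-- The lists of `h` natural numbers with sum `m`. -/
def listsWithSum : ℕ → ℕ → Finset (List ℕ)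
  | 0, m => if m = 0 then {[]} else ∅
  | h + 1, m => (antidiagonal m).biUnion fun p => (listsWithSum h p.2).image (List.cons p.1)

theorem mem_listsWithSum {h m : ℕ} {l : List ℕ} :
    l ∈ listsWithSum h m ↔ l.length = h ∧ l.sum = m := by
  induction h generalizing m l with
  | zero =>
    rw [listsWithSum]
    split_ifs with hm
    · subst hm
      simp only [mem_singleton, List.length_eq_zero_iff]
      exact ⟨fun h => by simp [h], fun h => h.1⟩
    · simp only [notMem_empty, List.length_eq_zero_iff, false_iff]
      rintro ⟨rfl, h⟩
      exact hm h.symm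
  | succ h ih =>
    simp only [listsWithSum, mem_biUnion, mem_image, HasAntidiagonal.mem_antidiagonal, ih]
    constructor
    · rintro ⟨p, hp, l', ⟨h1, h2⟩, rfl⟩
      simp [h1, h2, hp]
    · rintro ⟨h1, h2⟩
      cases l with
      | nil => simp at h1
      | cons a l => exact ⟨(a, l.sum), by simpa using h2, l, ⟨by simpa using h1, rfl⟩, rfl⟩

theorem coeff_mk_pow {R : Type*} [CommSemiring R] (φ : ℕ → R) (h m : ℕ) :
    PowerSeries.coeff m (PowerSeries.mk φ ^ h)
      = ∑ l ∈ listsWithSum h m, (l.map φ).prod := by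
  induction h generalizing m with
  | zero =>
    rw [pow_zero, PowerSeries.coeff_one, listsWithSum]
    split_ifs <;> simp
  | succ h ih =>
    rw [pow_succ', PowerSeries.coeff_mul, listsWithSum, sum_biUnion]
    · refine sum_congr rfl fun p _ => ?_
      rw [sum_image (fun a _ b _ hab => (List.cons.inj hab).2), ih, mul_sum]
      simp
    · intro p hp q hq hpq
      rw [Function.onFun, disjoint_left]
      intro l hl hl'
      obtain ⟨a, -, rfl⟩ := mem_image.1 hl
      obtain ⟨b, -, hb⟩ := mem_image.1 hl'
      have h1 : q.1 = p.1 := (List.cons.inj hb).1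
      have h2 := HasAntidiagonal.mem_antidiagonal.1 hp
      have h3 := HasAntidiagonal.mem_antidiagonal.1 hq
      exact hpq (Prod.ext h1.symm (by omega))

theorem sum_compositions {R : Type*} [AddCommMonoid R] (h m : ℕ) (ψ : List ℕ → R) :
    ∑ p : Composition m with p.length = h, ψ p.blocks
      = ∑ l ∈ listsWithSum h m with ∀ a ∈ l, 0 < a, ψ l := by
  refine sum_bij (fun p _ => p.blocks) ?_ ?_ ?_ ?_
  · intro p hp
    simp only [mem_filter, mem_univ, true_and] at hp
    simp only [mem_filter, mem_listsWithSum]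
    exact ⟨⟨hp, p.blocks_sum⟩, fun a ha => p.blocks_pos ha⟩
  · intro p _ q _ hpq
    exact Composition.ext hpq
  · intro l hl
    simp only [mem_filter, mem_listsWithSum] at hl
    exact ⟨⟨l, fun {i} hi => hl.2 i hi, hl.1.2⟩, by simpa [Composition.length] using hl.1.1, rfl⟩
  · intro p _
    rfl

end Lists

/-! ### Generating functions for column deletion -/

section GeneratingFunction

open Polynomial PowerSeries

theorem prod_map_X_pow (φ : ℕ → ℕ) (l : List ℕ) :
    (l.map fun a => (Polynomial.X : ℕ[X]) ^ φ a).prod = Polynomial.X ^ (l.map φ).sum := by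
  induction l with
  | nil => simp
  | cons a l ih => simp [ih, pow_add]

/-- A vanishing constant coefficient kills every list with an empty row, so that powers of such a
series are sums over compositions. -/
theorem prod_map_ite_zero {R : Type*} [CommSemiring R] (φ : ℕ → R) (l : List ℕ) :
    (l.map fun a => if a = 0 then 0 else φ a).prod
      = if ∀ a ∈ l, 0 < a then (l.map φ).prod else 0 := by
  induction l with
  | nil => simp
  | cons a l ih =>
    rcases Nat.eq_zero_or_pos a with rfl | ha
    · simp
    · simp only [List.map_cons, List.prod_cons, ih, ha.ne', if_false, List.forall_mem_cons, ha,
        true_and]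
      split_ifs <;> simp

theorem remWeight_eq (r : ℕ) {m : ℕ} (p : Composition m) :
    remWeight r p = (p.blocks.map fun a => a - r).sum := by
  rw [remWeight, deleteColumns]
  induction p.blocks with
  | nil => rfl
  | cons a l ih =>
    rw [List.map_cons, List.filter_cons]
    split_ifs with h
    · simp [ih]
    · have : a - r = 0 := by simp at h; omega
      simp only [ih, List.sum_cons, this, zero_add]

/-- The generating function of one nonempty row: the power series variable marks the length,
the polynomial variable the number of cells that survive the deletion of `r` columns. -/
noncomputable def rowSeries (r : ℕ) : ℕ[X]⟦X⟧ :=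
  PowerSeries.mk fun a => if a = 0 then 0 else Polynomial.X ^ (a - r)

/-- A nonempty row is its first cell followed by a possibly empty row, from which `r` further
columns are to be deleted. -/
theorem rowSeries_succ (r : ℕ) : rowSeries (r + 1) = PowerSeries.X * (1 + rowSeries r) := by
  ext1 a
  cases a with
  | zero => simp [rowSeries]
  | succ a =>
    rw [PowerSeries.coeff_succ_X_mul, map_add, rowSeries, rowSeries, PowerSeries.coeff_mk,
      PowerSeries.coeff_mk, PowerSeries.coeff_one, if_neg a.succ_ne_zero, Nat.add_sub_add_right]
    split_ifs with h <;> simp [h]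

theorem one_add_rowSeries (r : ℕ) :
    1 + rowSeries r = PowerSeries.mk fun a => Polynomial.X ^ (a - r) := by
  ext1 a
  rw [map_add, rowSeries, PowerSeries.coeff_mk, PowerSeries.coeff_mk, PowerSeries.coeff_one]
  split_ifs with h <;> simp [h]

theorem coeff_one_add_rowSeries_pow (r n m g : ℕ) :
    (PowerSeries.coeff m ((1 + rowSeries r) ^ n)).coeff g
      = #{l ∈ listsWithSum n m | (l.map fun a => a - r).sum = g} := by
  rw [one_add_rowSeries, coeff_mk_pow]
  simp only [prod_map_X_pow, finsetSum_coeff, Polynomial.coeff_X_pow, card_filter]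
  exact sum_congr rfl fun l _ => by simp only [eq_comm]

/-- The number of compositions of `m` into `h` parts that leave weight `g` after deletion of the
first `r` columns. -/
def remNum (r m g h : ℕ) : ℕ :=
  #{p : Composition m | p.length = h ∧ remWeight r p = g}

theorem coeff_rowSeries_pow (r h m g : ℕ) :
    (PowerSeries.coeff m (rowSeries r ^ h)).coeff g = remNum r m g h := by
  have := sum_compositions (R := ℕ) h m fun l => if (l.map fun a => a - r).sum = g then 1 else 0
  rw [rowSeries, coeff_mk_pow]
  simp only [prod_map_ite_zero, prod_map_X_pow]
  rw [← sum_filter, finsetSum_coeff, remNum, ← filter_filter, card_filter]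
  simp only [remWeight_eq]
  rw [this]
  exact sum_congr rfl fun l _ => by simp only [Polynomial.coeff_X_pow, eq_comm]

/-- The binomial theorem chooses which `h` of the `n` rows are nonempty. -/
theorem coeff_one_add_rowSeries_pow_eq_sum (r n m g : ℕ) :
    (PowerSeries.coeff m ((1 + rowSeries r) ^ n)).coeff g
      = ∑ h ∈ range (n + 1), n.choose h * remNum r m g h := by
  rw [add_comm, add_pow, map_sum, finsetSum_coeff]
  refine sum_congr rfl fun h _ => ?_
  rw [one_pow, mul_one, mul_comm, ← coeff_rowSeries_pow, ← nsmul_eq_mul, map_nsmul,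
    Polynomial.coeff_smul, smul_eq_mul]

/-- The factor `X ^ h` is the first column; `f` counts the rows that reach the second one. -/
theorem remNum_succ (r m g h : ℕ) :
    remNum (r + 1) m g h
      = if h ≤ m then ∑ f ∈ range (h + 1), h.choose f * remNum r (m - h) g f else 0 := by
  rw [← coeff_rowSeries_pow, rowSeries_succ, mul_pow, PowerSeries.coeff_X_pow_mul']
  split_ifs with hm
  · exact coeff_one_add_rowSeries_pow_eq_sum ..
  · simp

theorem remNum_zero (m g h : ℕ) : remNum 0 m g h = if m = g then deMoivre m h else 0 := by
  have (p : Composition m) : remWeight 0 p = m := by simp [remWeight_eq]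
  simp only [remNum, this, deMoivre]
  split_ifs with h <;> simp [h]

theorem deMoivre_zero_right {m : ℕ} (hm : 1 ≤ m) : deMoivre m 0 = 0 := by
  rw [deMoivre, card_eq_zero, filter_eq_empty_iff]
  intro p _ hp
  have := p.length_pos_of_pos hm
  omega

theorem deMoivre_zero_left (h : ℕ) : deMoivre 0 h = if h = 0 then 1 else 0 := by
  have (p : Composition 0) : p.length = 0 := by
    have := p.length_le
    omega
  simp only [deMoivre, this]
  split_ifs with h
  · simp [h, composition_card]
  · simp [Ne.symm h]

/-- Read off the coefficient of `X ^ (m + 1)` in `(X / (1 - X)) ^ (h + 1)`. -/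
theorem deMoivre_succ_succ (m h : ℕ) : deMoivre (m + 1) (h + 1) = m.choose h := by
  have hser : (PowerSeries.mk fun a => if a = 0 then 0 else 1 : ℤ⟦X⟧)
      = PowerSeries.X * PowerSeries.mk 1 := by
    ext a
    cases a with
    | zero => simp
    | succ a => simp [PowerSeries.coeff_succ_X_mul]
  have key := coeff_mk_pow (R := ℤ) (fun a => if a = 0 then 0 else 1) (h + 1) (m + 1)
  simp only [prod_map_ite_zero] at key
  rw [← sum_filter, ← sum_compositions (R := ℤ) _ _ fun l => (l.map fun _ => (1 : ℤ)).prod, hser,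
    mul_pow, PowerSeries.coeff_X_pow_mul', PowerSeries.mk_one_pow_eq_mk_choose_add,
    PowerSeries.coeff_mk] at key
  simp only [List.map_const', List.prod_replicate, one_pow, sum_const, nsmul_eq_mul,
    mul_one] at key
  rw [deMoivre]
  apply Nat.cast_injective (R := ℤ)
  rw [← key]
  split_ifs with hm
  · rw [show h + (m + 1 - (h + 1)) = m by omega]
  · rw [Nat.choose_eq_zero_of_lt (by omega), Nat.cast_zero]

end GeneratingFunction

/-! ### Chain sums and their column recursion -/

section Chains

theorem chainProd_cons {r : ℕ} (j : ℕ) (F : Fin (r + 1) → ℕ) :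
    chainProd (Fin.cons j F : Fin (r + 2) → ℕ) = j.choose (F 0) * chainProd F := by
  rw [chainProd, Fin.prod_univ_succ, chainProd]
  rfl

theorem chainProd_snoc_zero {r : ℕ} (F : Fin (r + 1) → ℕ) :
    chainProd (Fin.snoc F 0 : Fin (r + 2) → ℕ) = chainProd F := by
  rw [chainProd, Fin.prod_univ_castSucc, chainProd]
  simp [← Fin.castSucc_succ]

/-- The sum over the chains from `j` to `k` of the products of binomial coefficients. -/
def chainSum (s i g j k : ℕ) : ℕ :=
  ∑ f ∈ chains s i g j k,
    chainProd (Fin.cons j (Fin.snoc f k : Fin (s + 1) → ℕ) : Fin (s + 2) → ℕ)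

/-- Appending `k = 0` costs only the factor `C(f_s, 0) = 1`, so `chainSum` serves both cases of `c`.
-/
theorem c_zero_eq (s i j : ℕ) : c s i 0 j = chainSum s i 0 j 0 := by
  rw [c, if_pos rfl, chainSum, Nat.cast_sum]
  refine sum_congr rfl fun f _ => ?_
  rw [Fin.cons_snoc_eq_snoc_cons, chainProd_snoc_zero]

theorem c_eq_of_ne_zero {g : ℕ} (hg : g ≠ 0) (s i j : ℕ) :
    c s i g j = 1 / (g : ℚ) * ∑ k ∈ Icc 1 g, (k : ℚ) * chainSum s i g j k * (g.choose k : ℚ) := by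
  simp only [c, if_neg hg, chainSum, Nat.cast_sum, mul_sum, sum_mul]

theorem mem_chains {s i g j k : ℕ} {f : Fin s → ℕ} :
    f ∈ chains s i g j k ↔ (∀ a, k ≤ f a ∧ f a ≤ j) ∧ Antitone f ∧ (∑ a, f a) + j + g = i := by
  simp only [chains, mem_filter, Fintype.mem_piFinset, mem_Icc]
  rfl

theorem chains_zero (i g j k : ℕ) : chains 0 i g j k = if j + g = i then univ else ∅ := by
  ext f
  rw [mem_chains]
  split_ifs with h
  · exact iff_of_true ⟨fun a => a.elim0, Subsingleton.antitone f, by simpa using h⟩ (mem_univ f)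
  · simp [h]

theorem chainSum_zero (i g j k : ℕ) :
    chainSum 0 i g j k = if j + g = i then j.choose k else 0 := by
  rw [chainSum, chains_zero]
  split_ifs with h
  · simp [chainProd, Fin.snoc]
  · simp

theorem chainSum_eq_zero_of_lt {s i g j k : ℕ} (h : j < k) : chainSum s i g j k = 0 := by
  cases s with
  | zero => rw [chainSum_zero, Nat.choose_eq_zero_of_lt h, ite_self]
  | succ s =>
    refine sum_eq_zero fun f hf => ?_
    have := (mem_chains.1 hf).1 0
    omega

theorem antitone_cons_iff {s : ℕ} (a : ℕ) (f : Fin s → ℕ) :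
    Antitone (Fin.cons a f : Fin (s + 1) → ℕ) ↔ (∀ b, f b ≤ a) ∧ Antitone f := by
  constructor
  · intro h
    refine ⟨fun b => ?_, fun b c hbc => ?_⟩
    · simpa using h (Fin.zero_le b.succ)
    · simpa using h (Fin.succ_le_succ_iff.2 hbc)
  · rintro ⟨h1, h2⟩ b c hbc
    cases b using Fin.cases with
    | zero =>
      cases c using Fin.cases with
      | zero => simp
      | succ c => simpa using h1 c
    | succ b =>
      cases c using Fin.cases with
      | zero => exact absurd hbc (by simp)
      | succ c => simpa using h2 (Fin.succ_le_succ_iff.1 hbc)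

theorem cons_mem_chains {s i g j k a : ℕ} {f : Fin s → ℕ} :
    (Fin.cons a f : Fin (s + 1) → ℕ) ∈ chains (s + 1) i g j k
      ↔ j ≤ i ∧ a ∈ Icc k j ∧ f ∈ chains s (i - j) g a k := by
  simp only [mem_chains, antitone_cons_iff, Fin.forall_fin_succ, Fin.cons_zero, Fin.cons_succ,
    Fin.sum_univ_succ, mem_Icc]
  constructor
  · rintro ⟨⟨h1, h2⟩, ⟨h3, h4⟩, h5⟩
    exact ⟨by omega, h1, fun b => ⟨(h2 b).1, h3 b⟩, h4, by omega⟩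
  · rintro ⟨h0, h1, h2, h4, h5⟩
    exact ⟨⟨h1, fun b => ⟨(h2 b).1, (h2 b).2.trans h1.2⟩⟩, ⟨fun b => (h2 b).2, h4⟩, by omega⟩

/-- Strip `f₁` from the chain. Summing from 0 instead of from `k` adds only zeros, and makes the
coefficients free of `k` and of the same shape as in `remNum_succ`. -/
theorem chainSum_succ (s i g j k : ℕ) :
    chainSum (s + 1) i g j k
      = if j ≤ i then ∑ f ∈ range (j + 1), j.choose f * chainSum s (i - j) g f k else 0 := by
  split_ifs with hij
  · have hsub : Icc k j ⊆ range (j + 1) := fun a ha => by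
      have := mem_Icc.1 ha
      exact mem_range.2 (by omega)
    rw [← sum_subset hsub]
    · simp only [chainSum, mul_sum]
      rw [sum_sigma']
      symm
      refine sum_bij (fun x _ => (Fin.cons x.1 x.2 : Fin (s + 1) → ℕ)) ?_ ?_ ?_ ?_
      · rintro ⟨a, f⟩ hx
        exact cons_mem_chains.2 ⟨hij, mem_sigma.1 hx⟩
      · rintro ⟨a, f⟩ _ ⟨b, f'⟩ _ h
        obtain ⟨rfl, rfl⟩ := Fin.cons_injective2 h
        rfl
      · intro f hf
        refine ⟨⟨f 0, Fin.tail f⟩, mem_sigma.2 ?_, Fin.cons_self_tail f⟩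
        rw [← Fin.cons_self_tail f, cons_mem_chains] at hf
        exact hf.2
      · rintro ⟨a, f⟩ _
        rw [← Fin.cons_snoc_eq_snoc_cons, chainProd_cons j, Fin.cons_zero]
    · intro a ha ha'
      rw [chainSum_eq_zero_of_lt, mul_zero]
      simp only [mem_range, mem_Icc, not_and, not_le] at ha ha'
      by_contra hk
      have := ha' (not_lt.1 hk)
      omega
  · refine sum_eq_zero fun f hf => ?_
    have := (mem_chains.1 hf).2.2
    omega

/-- The recursion for `chainSum` is linear with coefficients independent of `k`, so it survives the
weighted sum over `k`. -/
theorem c_succ (s m g h : ℕ) :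
    c (s + 1) m g h
      = if h ≤ m then ∑ f ∈ range (h + 1), (h.choose f : ℚ) * c s (m - h) g f else 0 := by
  rcases eq_or_ne g 0 with rfl | hg
  · simp only [c_zero_eq, chainSum_succ]
    split_ifs <;> push_cast <;> rfl
  · simp only [c_eq_of_ne_zero hg, chainSum_succ]
    split_ifs
    · push_cast
      simp only [mul_sum, sum_mul]
      rw [sum_comm]
      exact sum_congr rfl fun _ _ => sum_congr rfl fun _ _ => by ring
    · simp

theorem mul_choose_eq_mul_deMoivre {g : ℕ} (hg : g ≠ 0) (k : ℕ) :
    k * g.choose k = g * deMoivre g k := by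
  obtain ⟨g, rfl⟩ := Nat.exists_eq_succ_of_ne_zero hg
  cases k with
  | zero => simp [deMoivre_zero_right]
  | succ k =>
    rw [Nat.succ_eq_add_one, deMoivre_succ_succ, Nat.add_one_mul_choose_eq]
    ring

theorem deMoivre_eq_zero_of_lt {m h : ℕ} (hm : m < h) : deMoivre m h = 0 := by
  rw [deMoivre, card_eq_zero, filter_eq_empty_iff]
  intro p _ hp
  have := p.length_le
  omega

/-- Deleting one column leaves `m - h` cells. For `m = h + g` both sides count the choices of `k`
surviving rows and of a composition of `g` into `k` parts; otherwise both vanish. -/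
theorem c_zero_left (m g h : ℕ) : c 0 m g h = remNum 1 m g h := by
  rw [show (1 : ℕ) = 0 + 1 from rfl, remNum_succ]
  simp only [remNum_zero]
  rcases eq_or_ne g 0 with rfl | hg
  · rw [c_zero_eq, chainSum_zero]
    by_cases hm : m = h
    · subst hm
      simp only [add_zero, le_refl, if_true, Nat.sub_self, deMoivre_zero_left, Nat.choose_zero_right]
      simp
    · rw [if_neg (by omega), ite_eq_right_iff.2]
      intro h1
      rw [sum_eq_zero]
      intro f _
      rw [if_neg (by omega), mul_zero]
  · rw [c_eq_of_ne_zero hg]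
    simp only [chainSum_zero]
    by_cases hm : h + g = m
    · subst hm
      simp only [if_true, Nat.le_add_right, Nat.add_sub_cancel_left]
      have hg' : (g : ℚ) ≠ 0 := Nat.cast_ne_zero.2 hg
      rw [one_div, inv_mul_eq_iff_eq_mul₀ hg']
      norm_cast
      rw [mul_sum]
      have hterm (k : ℕ) : k * h.choose k * g.choose k = g * (h.choose k * deMoivre g k) := by
        rw [mul_right_comm, mul_choose_eq_mul_deMoivre hg]
        ring
      simp only [hterm]
      -- Both sums are extended to a common range: `C(h, k) = 0` for `k > h`, and `M^k_g = 0` for `k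
      -- = 0` and for `k > g`.
      have h1 : Icc 1 g ⊆ range (h + g + 1) := fun a ha => by
        have := mem_Icc.1 ha
        exact mem_range.2 (by omega)
      have h2 : range (h + 1) ⊆ range (h + g + 1) := range_mono (by omega)
      rw [sum_subset h1, sum_subset h2]
      · intro k _ hk
        rw [Nat.choose_eq_zero_of_lt (by simpa using hk), zero_mul, mul_zero]
      · intro k _ hk
        have : deMoivre g k = 0 := by
          rcases Nat.eq_zero_or_pos k with rfl | hk0
          · exact deMoivre_zero_right (Nat.one_le_iff_ne_zero.2 hg)
          · refine deMoivre_eq_zero_of_lt ?_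
            by_contra hgk
            exact hk (mem_Icc.2 ⟨hk0, not_lt.1 hgk⟩)
        rw [this, mul_zero, mul_zero]
    · simp only [if_neg hm, Nat.cast_zero, mul_zero, zero_mul, sum_const_zero]
      rw [ite_eq_right_iff.2, Nat.cast_zero]
      intro h1
      rw [sum_eq_zero]
      intro f _
      rw [if_neg (by omega), mul_zero]

theorem remNum_eq_c (s m g h : ℕ) : (remNum (s + 1) m g h : ℚ) = c s m g h := by
  induction s generalizing m h with
  | zero => exact (c_zero_left m g h).symm
  | succ s ih =>
    rw [remNum_succ, c_succ]
    split_ifs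
    · push_cast
      simp only [← ih]
    · rfl

theorem remCount_eq_c (s m g h : ℕ) : (remCount s m g h : ℚ) = c s m g h :=
  remNum_eq_c s m g h

end Chains

/-! ### Binary words, runs of zeros and rotations -/

section Words

/-- The number of places at which `k` consecutive zeros begin in a (linear) word. -/
def zeroRuns (k : ℕ) : List (Fin 2) → ℕ
  | [] => 0
  | x :: v => (if List.replicate k 0 <+: x :: v then 1 else 0) + zeroRuns k v

/-- The numbers of zeros before the first one, between consecutive ones, and after the last one
of a word; the first of these numbers is kept apart. -/
def gaps : List (Fin 2) → ℕ × List ℕ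
  | [] => (0, [])
  | x :: v => if x = 0 then ((gaps v).1 + 1, (gaps v).2) else (0, (gaps v).1 :: (gaps v).2)

theorem gaps_zero_cons (v : List (Fin 2)) :
    gaps (0 :: v) = ((gaps v).1 + 1, (gaps v).2) := by
  simp [gaps]

theorem gaps_one_cons (v : List (Fin 2)) :
    gaps (1 :: v) = (0, (gaps v).1 :: (gaps v).2) := by
  simp [gaps]

theorem eq_zero_or_eq_one (x : Fin 2) : x = 0 ∨ x = 1 := by
  revert x
  decide

theorem gaps_injective : Function.Injective gaps := by
  intro v
  induction v with
  | nil =>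
    intro w h
    cases w with
    | nil => rfl
    | cons y w =>
      rcases eq_zero_or_eq_one y with rfl | rfl
      · rw [gaps_zero_cons] at h
        exact absurd (congrArg Prod.fst h) (by simp [gaps])
      · rw [gaps_one_cons] at h
        exact absurd (congrArg Prod.snd h) (by simp [gaps])
  | cons x v ih =>
    intro w h
    cases w with
    | nil =>
      rcases eq_zero_or_eq_one x with rfl | rfl
      · rw [gaps_zero_cons] at h
        exact absurd (congrArg Prod.fst h) (by simp [gaps])
      · rw [gaps_one_cons] at h
        exact absurd (congrArg Prod.snd h) (by simp [gaps])
    | cons y w =>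
      rcases eq_zero_or_eq_one x with rfl | rfl <;> rcases eq_zero_or_eq_one y with rfl | rfl
      · simp only [gaps_zero_cons, Prod.mk.injEq, Nat.add_right_cancel_iff] at h
        rw [ih (Prod.ext h.1 h.2)]
      · simp [gaps_zero_cons, gaps_one_cons] at h
      · simp [gaps_zero_cons, gaps_one_cons] at h
      · simp only [gaps_one_cons, Prod.mk.injEq, List.cons.injEq, true_and] at h
        rw [ih (Prod.ext h.1 h.2)]

theorem gaps_surjective : Function.Surjective gaps := by
  rintro ⟨a, l⟩
  induction l generalizing a with
  | nil =>
    induction a with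
    | zero => exact ⟨[], rfl⟩
    | succ a ih =>
      obtain ⟨v, hv⟩ := ih
      exact ⟨0 :: v, by rw [gaps_zero_cons, hv]⟩
  | cons b l ih =>
    induction a with
    | zero =>
      obtain ⟨v, hv⟩ := ih b
      exact ⟨1 :: v, by rw [gaps_one_cons, hv]⟩
    | succ a ih =>
      obtain ⟨v, hv⟩ := ih
      exact ⟨0 :: v, by rw [gaps_zero_cons, hv]⟩

theorem length_gaps (v : List (Fin 2)) : (gaps v).2.length = v.count 1 := by
  induction v with
  | nil => rfl
  | cons x v ih =>
    rcases eq_zero_or_eq_one x with rfl | rfl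
    · simp [gaps_zero_cons, ih]
    · simp [gaps_one_cons, ih]

theorem sum_gaps (v : List (Fin 2)) : (gaps v).1 + (gaps v).2.sum = v.count 0 := by
  induction v with
  | nil => rfl
  | cons x v ih =>
    rcases eq_zero_or_eq_one x with rfl | rfl
    · simp [gaps_zero_cons, ← ih, add_right_comm]
    · simp [gaps_one_cons, ih]

theorem replicate_zero_prefix_iff (k : ℕ) (v : List (Fin 2)) :
    List.replicate k 0 <+: v ↔ k ≤ (gaps v).1 := by
  induction v generalizing k with
  | nil =>
    cases k with
    | zero => simp
    | succ k => simp [gaps, List.replicate_succ]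
  | cons x v ih =>
    cases k with
    | zero => simp
    | succ k =>
      rw [List.replicate_succ, List.cons_prefix_cons, ih]
      rcases eq_zero_or_eq_one x with rfl | rfl
      · simp [gaps_zero_cons]
      · simp [gaps_one_cons]

/-- Prepending a zero lengthens the first run, and creates a new occurrence exactly when that run
now has at least `r + 1` zeros. -/
theorem zeroRuns_eq (r : ℕ) (v : List (Fin 2)) :
    zeroRuns (r + 1) v = ((gaps v).1 - r) + ((gaps v).2.map fun a => a - r).sum := by
  induction v with
  | nil => simp [zeroRuns, gaps]
  | cons x v ih =>
    simp only [zeroRuns, replicate_zero_prefix_iff, ih]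
    rcases eq_zero_or_eq_one x with rfl | rfl
    · rw [gaps_zero_cons]
      split_ifs with h <;> simp only at h ⊢ <;> omega
    · rw [gaps_one_cons]
      simp

theorem zeroRuns_ofFn (k : ℕ) {N : ℕ} (α : Fin N → Fin 2) :
    zeroRuns k (List.ofFn α)
      = #{i : Fin N | List.replicate k 0 <+: (List.ofFn α).drop i.val} := by
  rw [card_filter]
  induction N with
  | zero => simp [zeroRuns]
  | succ N ih =>
    rw [Fin.sum_univ_succ, List.ofFn_succ, zeroRuns, ih]
    simp

theorem card_filter_eq_count {N : ℕ} (α : Fin N → Fin 2) (x : Fin 2) :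
    #{i | α i = x} = (List.ofFn α).count x := by
  rw [card_filter]
  induction N with
  | zero => simp
  | succ N ih =>
    rw [Fin.sum_univ_succ, List.ofFn_succ, List.count_cons, ih]
    simp [add_comm]

theorem occ_replicate {N : ℕ} (k : ℕ) (x : Fin 2) (α : Fin N → Fin 2) :
    occ (List.replicate k x) α
      = #{i : Fin N | ∀ j < k, α ⟨(i.val + j) % N, Nat.mod_lt _ i.pos⟩ = x} := by
  rw [occ]
  congr 1
  ext i
  simp only [mem_filter, mem_univ, true_and]
  constructor
  · intro h j hj
    simpa using h ⟨j, by simpa using hj⟩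
  · intro h j
    simpa using h j.val (by simpa using j.isLt)

/-- A block of zeros cannot wrap around past the one at position 0, so cyclic and linear occurrences
coincide. -/
theorem occ_eq_zeroRuns {N k : ℕ} (α : Fin (N + 1) → Fin 2) (h0 : α 0 = 1) :
    occ (List.replicate (k + 1) 0) α = zeroRuns (k + 1) (List.ofFn α) := by
  rw [occ_replicate, zeroRuns_ofFn]
  congr 1
  ext i
  simp only [mem_filter, mem_univ, true_and, List.prefix_iff_getElem?, List.length_replicate,
    List.getElem_replicate, List.getElem?_drop, List.getElem?_ofFn]
  constructor
  · intro h j hj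
    have hlt : i.val + j < N + 1 := by
      by_contra hle
      -- The offset at which a wrapping block would meet position 0.
      have := h (N + 1 - i.val) (by omega)
      rw [show (⟨(i.val + (N + 1 - i.val)) % (N + 1), Nat.mod_lt _ i.pos⟩ : Fin (N + 1)) = 0 from
        Fin.ext (by simp [Nat.add_sub_cancel' i.isLt.le]), h0] at this
      exact absurd this (by decide)
    have := h j hj
    rw [dif_pos hlt, Option.some_inj, ← this]
    congr 2
    exact (Nat.mod_eq_of_lt hlt).symm
  · intro h j hj
    have := h j hj
    split_ifs at this with hlt
    rw [Option.some_inj] at this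
    rw [← this]
    congr 2
    exact Nat.mod_eq_of_lt hlt

/-- The binary sequences of length `N` with `m` zeros and `n` ones in which the string `U` occurs
cyclically exactly `g` times. -/
def seqs (N m n : ℕ) (U : List (Fin 2)) (g : ℕ) : Finset (Fin N → Fin 2) :=
  univ.filter fun α =>
    (univ.filter fun i => α i = 0).card = m ∧ (univ.filter fun i => α i = 1).card = n ∧
      occ U α = g

theorem mem_seqs {N m n g : ℕ} {U : List (Fin 2)} {α : Fin N → Fin 2} :
    α ∈ seqs N m n U g ↔ #{i | α i = 0} = m ∧ #{i | α i = 1} = n ∧ occ U α = g := by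
  simp [seqs]

/-- Keeping the length as a separate parameter lets it be rewritten as `N + 1`, and lets `m` and `n`
be exchanged at fixed length. -/
theorem T_eq (m n : ℕ) (U : List (Fin 2)) (g : ℕ) : T m n U g = #(seqs (m + n) m n U g) :=
  rfl

/-- The word after the leading one has `n - 1` ones, hence `n` runs of zeros, and `gaps` is a
bijection. -/
theorem card_filter_seqs {N m n : ℕ} (hN : N + 1 = m + n) (hn : 1 ≤ n) (r g : ℕ) :
    #{α ∈ seqs (N + 1) m n (List.replicate (r + 1) 0) g | α 0 = 1}
      = #{l ∈ listsWithSum n m | (l.map fun a => a - r).sum = g} := by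
  have key (v : List (Fin 2)) (α : Fin (N + 1) → Fin 2) (h0 : α 0 = 1)
      (hα : List.ofFn α = 1 :: v) :
      α ∈ seqs (N + 1) m n (List.replicate (r + 1) 0) g ↔
        (gaps v).1 :: (gaps v).2 ∈ listsWithSum n m ∧
          (((gaps v).1 :: (gaps v).2).map fun a => a - r).sum = g := by
    rw [mem_seqs, card_filter_eq_count, card_filter_eq_count, occ_eq_zeroRuns α h0, hα,
      mem_listsWithSum, zeroRuns_eq, gaps_one_cons]
    simp only [List.count_cons, List.length_cons, List.sum_cons, List.map_cons, length_gaps,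
      sum_gaps]
    simp [and_assoc, and_left_comm]
  have hcons (α : Fin (N + 1) → Fin 2) (h0 : α 0 = 1) :
      List.ofFn α = 1 :: List.ofFn (Fin.tail α) := by
    rw [List.ofFn_succ, h0]
    rfl
  refine card_bij (fun α _ => (gaps (List.ofFn (Fin.tail α))).1 ::
    (gaps (List.ofFn (Fin.tail α))).2) ?_ ?_ ?_
  · intro α hα
    obtain ⟨hα, h0⟩ := mem_filter.1 hα
    exact mem_filter.2 ((key _ α h0 (hcons α h0)).1 hα)
  · intro α hα β hβ h
    have h0 := (mem_filter.1 hα).2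
    have h0' := (mem_filter.1 hβ).2
    rw [List.cons.injEq] at h
    have := List.ofFn_injective (gaps_injective (Prod.ext h.1 h.2))
    rw [← Fin.cons_self_tail α, ← Fin.cons_self_tail β, this, h0, h0']
  · intro l hl
    have hl' := (mem_filter.1 hl).1
    rw [mem_listsWithSum] at hl'
    cases l with
    | nil => simp at hl'; omega
    | cons a l =>
      obtain ⟨v, hv⟩ := gaps_surjective (a, l)
      have h1 := length_gaps v
      have h2 := sum_gaps v
      rw [hv] at h1 h2
      have h3 : v.length = v.count 0 + v.count 1 := by
        clear hv h1 h2
        induction v with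
        | nil => rfl
        | cons x v ih =>
          rcases eq_zero_or_eq_one x with rfl | rfl <;> simp [ih] <;> omega
      simp only [List.length_cons, List.sum_cons] at hl' h1 h2
      have hlen : v.length = N := by omega
      subst hlen
      have htail : List.ofFn (Fin.tail (Fin.cons 1 v.get : Fin (v.length + 1) → Fin 2)) = v := by
        rw [Fin.tail_cons, List.ofFn_get]
      refine ⟨Fin.cons 1 v.get, mem_filter.2 ⟨?_, rfl⟩, ?_⟩
      · rw [key v _ rfl (by rw [hcons _ rfl, htail]), hv]
        exact mem_filter.1 hl
      · rw [htail, hv]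

/-- Written with addition in `Fin N`, a rotation becomes a translation, which commutes with the
offsets. -/
theorem occ_eq_add {N : ℕ} [NeZero N] (U : List (Fin 2)) (α : Fin N → Fin 2) :
    occ U α = #{i : Fin N | ∀ j : Fin U.length, α (i + Fin.ofNat N j) = U.get j} := by
  have h (i : Fin N) (j : ℕ) :
      (⟨(i.val + j) % N, Nat.mod_lt _ i.pos⟩ : Fin N) = i + Fin.ofNat N j :=
    Fin.ext (by simp [Fin.val_add])
  simp only [occ, h]

theorem occ_rotate {N : ℕ} (U : List (Fin 2)) (α : Fin (N + 1) → Fin 2) (t : Fin (N + 1)) :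
    occ U (fun i => α (i + t)) = occ U α := by
  rw [occ_eq_add, occ_eq_add]
  refine card_equiv (Equiv.addRight t) fun i => ?_
  simp only [mem_filter, mem_univ, true_and, Equiv.coe_addRight, add_right_comm]

theorem rotate_mem_seqs {N m n g : ℕ} {U : List (Fin 2)} (α : Fin (N + 1) → Fin 2)
    (t : Fin (N + 1)) : (fun i => α (i + t)) ∈ seqs (N + 1) m n U g ↔ α ∈ seqs (N + 1) m n U g := by
  have h (x : Fin 2) : #{i | α (i + t) = x} = #{i | α i = x} :=
    card_equiv (Equiv.addRight t) fun i => by simp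
  rw [mem_seqs, mem_seqs, h, h, occ_rotate]

theorem card_filter_seqs_eq {N m n g : ℕ} (U : List (Fin 2)) (t : Fin (N + 1)) :
    #{α ∈ seqs (N + 1) m n U g | α t = 1} = #{α ∈ seqs (N + 1) m n U g | α 0 = 1} := by
  refine card_equiv (Equiv.arrowCongr (Equiv.subRight t) (Equiv.refl _)) fun α => ?_
  have : (Equiv.arrowCongr (Equiv.subRight t) (Equiv.refl (Fin 2))) α = fun i => α (i + t) := by
    ext i
    simp
  simp only [this, mem_filter, rotate_mem_seqs, zero_add]

/-- Double count the pairs of a sequence and a position of a one in it; by rotation every position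
contributes equally. -/
theorem mul_card_seqs (N m n : ℕ) (U : List (Fin 2)) (g : ℕ) :
    n * #(seqs (N + 1) m n U g) = (N + 1) * #{α ∈ seqs (N + 1) m n U g | α 0 = 1} := by
  have key := sum_card_bipartiteAbove_eq_sum_card_bipartiteBelow
    (s := seqs (N + 1) m n U g) (t := (univ : Finset (Fin (N + 1)))) fun α i => α i = 1
  simp only [bipartiteAbove, bipartiteBelow, card_filter_seqs_eq] at key
  rw [sum_congr rfl fun α hα => (mem_seqs.1 hα).2.1] at key
  simpa [mul_comm] using key

theorem mul_T_zeros {m n : ℕ} (hn : 1 ≤ n) (r g : ℕ) :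
    n * T m n (List.replicate (r + 1) 0) g
      = (m + n) * ∑ h ∈ range (n + 1), n.choose h * remNum r m g h := by
  obtain ⟨N, hN⟩ : ∃ N, N + 1 = m + n := ⟨m + n - 1, by omega⟩
  rw [T_eq, ← hN, mul_card_seqs, card_filter_seqs hN hn, ← coeff_one_add_rowSeries_pow,
    coeff_one_add_rowSeries_pow_eq_sum]

/-- The involution `x ↦ 1 - x` exchanges the two digits. -/
theorem card_seqs_ones (N m n k g : ℕ) :
    #(seqs N m n (List.replicate k 1) g) = #(seqs N n m (List.replicate k 0) g) := by
  have hsub : ∀ x : Fin 2, (1 - x = 0 ↔ x = 1) ∧ (1 - x = 1 ↔ x = 0) ∧ 1 - (1 - x) = x := by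
    decide
  refine card_bij' (fun α _ i => 1 - α i) (fun α _ i => 1 - α i) ?_ ?_ ?_ ?_
  · intro α hα
    simpa [mem_seqs, occ_replicate, hsub, and_left_comm] using hα
  · intro α hα
    simpa [mem_seqs, occ_replicate, hsub, and_left_comm] using hα
  · intro α _
    funext i
    exact (hsub _).2.2
  · intro α _
    funext i
    exact (hsub _).2.2

theorem T_ones (m n k g : ℕ) :
    T m n (List.replicate k 1) g = T n m (List.replicate k 0) g := by
  rw [T_eq, T_eq, card_seqs_ones, add_comm]

end Words

/-! ### Weights that occur, and the case of one column -/

section Compositions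

theorem exists_list_of_le (r : ℕ) {h m : ℕ} (h1 : h ≤ m) (h2 : m ≤ r * h) :
    ∃ l : List ℕ, l.length = h ∧ l.sum = m ∧ ∀ a ∈ l, 0 < a ∧ a ≤ r := by
  induction h generalizing m with
  | zero => exact ⟨[], rfl, by simp at h2; simp [h2], by simp⟩
  | succ h ih =>
    rw [Nat.mul_succ] at h2
    have hr : 0 < r := by
      rcases Nat.eq_zero_or_pos r with rfl | hr
      · simp at h2; omega
      · exact hr
    have h3 : h ≤ r * h := Nat.le_mul_of_pos_left h hr
    -- The new part is the smallest admissible one, `max 1 (m - r * h)`; the others share the rest.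
    obtain ⟨l, hl1, hl2, hl3⟩ := ih (m := min (m - 1) (r * h)) (by omega) (by omega)
    refine ⟨(m - min (m - 1) (r * h)) :: l, by simp [hl1], ?_, ?_⟩
    · rw [List.sum_cons, hl2]
      omega
    · rw [List.forall_mem_cons]
      exact ⟨by omega, hl3⟩

theorem sum_map_sub_eq_zero {r : ℕ} {l : List ℕ} (hl : ∀ a ∈ l, a ≤ r) :
    (l.map fun a => a - r).sum = 0 := by
  rw [List.sum_eq_zero_iff]
  simp only [List.mem_map]
  rintro _ ⟨a, ha, rfl⟩
  exact Nat.sub_eq_zero_of_le (hl a ha)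

theorem sum_le_sum_map_sub_add (r : ℕ) (l : List ℕ) :
    l.sum ≤ (l.map fun a => a - r).sum + r * l.length := by
  induction l with
  | nil => simp
  | cons a l ih =>
    simp only [List.sum_cons, List.map_cons, List.length_cons, Nat.mul_succ]
    omega

theorem sum_map_sub_add_length_le (s : ℕ) {l : List ℕ} (hl : ∀ a ∈ l, 0 < a) :
    (l.map fun a => a - (s + 1)).sum + l.length ≤ l.sum := by
  induction l with
  | nil => simp
  | cons a l ih =>
    rw [List.forall_mem_cons] at hl
    have := ih hl.2
    simp only [List.sum_cons, List.map_cons, List.length_cons]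
    omega

/-- If anything survives, one row loses `s + 1` cells and every other row loses at least one. -/
theorem sum_map_sub_eq_zero_or_add_le (s : ℕ) {l : List ℕ} (hl : ∀ a ∈ l, 0 < a) :
    (l.map fun a => a - (s + 1)).sum = 0 ∨
      (l.map fun a => a - (s + 1)).sum + l.length + s ≤ l.sum := by
  induction l with
  | nil => simp
  | cons a l ih =>
    rw [List.forall_mem_cons] at hl
    have h1 := ih hl.2
    have h2 := sum_map_sub_add_length_le s hl.2
    simp only [List.sum_cons, List.map_cons, List.length_cons]
    omega

theorem exists_remWeight_iff {s m h g : ℕ} (h1 : 1 ≤ h) (hm : h ≤ m) :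
    (∃ p : Composition m, p.length = h ∧ remWeight (s + 1) p = g) ↔
      max 0 ((m : ℤ) - (s + 1) * h) ≤ g ∧ (g : ℤ) ≤ max 0 ((m : ℤ) - h - s) := by
  constructor
  · rintro ⟨p, rfl, hp⟩
    rw [remWeight_eq] at hp
    have h2 := sum_le_sum_map_sub_add (s + 1) p.blocks
    have h3 := sum_map_sub_eq_zero_or_add_le s fun a ha => p.blocks_pos (i := a) ha
    rw [hp, p.blocks_sum, p.blocks_length] at h2 h3
    zify at h2 h3
    omega
  · rintro ⟨h2, h3⟩
    have h4 : m ≤ g + (s + 1) * h := by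
      zify
      omega
    suffices ∃ l : List ℕ, l.length = h ∧ l.sum = m ∧ (∀ a ∈ l, 0 < a) ∧
        (l.map fun a => a - (s + 1)).sum = g by
      obtain ⟨l, hl1, hl2, hl3, hl4⟩ := this
      exact ⟨⟨l, fun {i} hi => hl3 i hi, hl2⟩, hl1, by rw [remWeight_eq, hl4]⟩
    rcases Nat.eq_zero_or_pos g with rfl | hg
    · obtain ⟨l, hl1, hl2, hl3⟩ := exists_list_of_le (s + 1) hm (by omega)
      exact ⟨l, hl1, hl2, fun a ha => (hl3 a ha).1, sum_map_sub_eq_zero fun a ha => (hl3 a ha).2⟩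
    · obtain ⟨h, rfl⟩ := Nat.exists_eq_add_of_le' h1
      rw [Nat.mul_succ] at h4
      -- A single row of length `s + 1 + g` carries all the surviving weight; the other rows have
      -- length at most `s + 1`.
      obtain ⟨l, hl1, hl2, hl3⟩ := exists_list_of_le (s + 1) (h := h) (m := m - (s + 1 + g))
        (by omega) (by omega)
      refine ⟨(s + 1 + g) :: l, by simp [hl1], by rw [List.sum_cons, hl2]; omega, ?_, ?_⟩
      · rw [List.forall_mem_cons]
        exact ⟨by omega, fun a ha => (hl3 a ha).1⟩
      · rw [List.map_cons, List.sum_cons, sum_map_sub_eq_zero fun a ha => (hl3 a ha).2]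
        omega

theorem remWeight_one_add_length {m : ℕ} (p : Composition m) : remWeight 1 p + p.length = m := by
  rw [remWeight_eq]
  have h (l : List ℕ) (hl : ∀ a ∈ l, 0 < a) : (l.map fun a => a - 1).sum + l.length = l.sum := by
    induction l with
    | nil => rfl
    | cons a l ih =>
      rw [List.forall_mem_cons] at hl
      have := ih hl.2
      simp only [List.sum_cons, List.map_cons, List.length_cons]
      omega
  rw [← p.blocks_length, h _ fun a ha => p.blocks_pos ha, p.blocks_sum]

theorem deMoivre_sub {m g : ℕ} (hg : g < m) : deMoivre m (m - g) = (m - 1).choose g := by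
  obtain ⟨k, rfl⟩ := Nat.exists_eq_add_of_lt hg
  rw [show g + k + 1 - g = k + 1 by omega, deMoivre_succ_succ, Nat.add_sub_cancel,
    Nat.choose_symm_add]

theorem card_remWeight_one {m : ℕ} (hm : 1 ≤ m) (g : ℕ) :
    #{p : Composition m | remWeight 1 p = g} = (m - 1).choose g := by
  rcases lt_or_ge g m with hg | hg
  · rw [← deMoivre_sub hg, deMoivre]
    congr 1
    ext p
    have := remWeight_one_add_length p
    simp only [mem_filter, mem_univ, true_and]
    omega
  · rw [Nat.choose_eq_zero_of_lt (by omega), card_eq_zero, filter_eq_empty_iff]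
    intro p _ hp
    have := remWeight_one_add_length p
    have := p.length_pos_of_pos hm
    omega

theorem remCount_zero {m : ℕ} (hm : 1 ≤ m) (g h : ℕ) :
    remCount 0 m g h = if h + g = m then (m - 1).choose g else 0 := by
  split_ifs with hh
  · rw [← card_remWeight_one hm, remCount]
    congr 1
    ext p
    have := remWeight_one_add_length p
    simp only [mem_filter, mem_univ, true_and, zero_add]
    omega
  · rw [remCount, card_eq_zero, filter_eq_empty_iff]
    rintro p _ ⟨h1, h2⟩
    have := remWeight_one_add_length p
    rw [zero_add] at h2
    omega

theorem remCount_eq_zero_of_lt {s m g h : ℕ} (hh : m < h) : remCount s m g h = 0 := by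
  rw [remCount, card_eq_zero, filter_eq_empty_iff]
  rintro p _ ⟨h1, -⟩
  have := p.length_le
  omega

theorem remCount_zero_right {s m g : ℕ} (hm : 1 ≤ m) : remCount s m g 0 = 0 := by
  rw [remCount, card_eq_zero, filter_eq_empty_iff]
  rintro p _ ⟨h1, -⟩
  have := p.length_pos_of_pos hm
  omega

end Compositions

/-! ### Counting strings of equal digits -/

section Strings

theorem T_zeros_eq_choose {m n : ℕ} (hm : 1 ≤ m) (hn : 1 ≤ n) (s g : ℕ) :
    (T m n (List.replicate (s + 2) 0) g : ℚ)
      = ((m + n : ℕ) : ℚ) / (n : ℚ) * ∑ h ∈ Icc 1 m, c s m g h * (n.choose h : ℚ) := by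
  have hn' : (n : ℚ) ≠ 0 := Nat.cast_ne_zero.2 (by omega)
  have key : n * T m n (List.replicate (s + 2) 0) g
      = (m + n) * ∑ h ∈ range (n + 1), n.choose h * remCount s m g h :=
    mul_T_zeros hn (s + 1) g
  have hsum : ∑ h ∈ range (n + 1), n.choose h * remCount s m g h
      = ∑ h ∈ Icc 1 m, remCount s m g h * n.choose h := by
    -- Again a common range: terms with `h > n` vanish by `C(n, h)`, those with `h = 0` or `h > m`
    -- because there is no such composition.
    have h1 : Icc 1 m ⊆ range (m + n + 1) := fun a ha => by
      have := mem_Icc.1 ha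
      exact mem_range.2 (by omega)
    rw [sum_subset h1, sum_subset (range_mono (by omega : n + 1 ≤ m + n + 1))]
    · exact sum_congr rfl fun _ _ => mul_comm _ _
    · intro h _ hh
      rw [Nat.choose_eq_zero_of_lt (by simpa using hh), zero_mul]
    · intro h _ hh
      rw [mem_Icc, not_and, not_le] at hh
      rcases Nat.eq_zero_or_pos h with rfl | h0
      · rw [remCount_zero_right hm, zero_mul]
      · rw [remCount_eq_zero_of_lt (hh h0), zero_mul]
  rw [hsum] at key
  simp only [← remCount_eq_c]
  rw [div_mul_eq_mul_div, eq_div_iff hn', mul_comm]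
  exact_mod_cast key

theorem div_mul_deMoivre {n h : ℕ} (hn : 1 ≤ n) (hh : 1 ≤ h) (N : ℚ) :
    N / (h : ℚ) * (deMoivre n h : ℚ) = N / (n : ℚ) * (n.choose h : ℚ) := by
  have hn' : (n : ℚ) ≠ 0 := Nat.cast_ne_zero.2 (by omega)
  have hh' : (h : ℚ) ≠ 0 := Nat.cast_ne_zero.2 (by omega)
  have := mul_choose_eq_mul_deMoivre (g := n) (by omega) h
  rw [div_mul_eq_mul_div, div_mul_eq_mul_div, div_eq_div_iff hh' hn', mul_assoc, mul_assoc]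
  congr 1
  rw [mul_comm, mul_comm (n.choose h : ℚ)]
  exact_mod_cast this.symm

theorem sum_div_mul_deMoivre {m n : ℕ} (hn : 1 ≤ n) (N : ℚ) (φ : ℕ → ℚ) :
    ∑ h ∈ Icc 1 m, N / (h : ℚ) * φ h * (deMoivre n h : ℚ)
      = N / (n : ℚ) * ∑ h ∈ Icc 1 m, φ h * (n.choose h : ℚ) := by
  rw [mul_sum]
  refine sum_congr rfl fun h hh => ?_
  rw [mul_right_comm, div_mul_deMoivre hn (mem_Icc.1 hh).1]
  ring

theorem T_zeros_eq_deMoivre {m n : ℕ} (hm : 1 ≤ m) (hn : 1 ≤ n) (s g : ℕ) :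
    (T m n (List.replicate (s + 2) 0) g : ℚ)
      = ∑ h ∈ Icc 1 m, ((m + n : ℕ) : ℚ) / (h : ℚ) * c s m g h * (deMoivre n h : ℚ) := by
  rw [sum_div_mul_deMoivre hn, T_zeros_eq_choose hm hn]

theorem T_two_zeros {m n g : ℕ} (hm : 1 ≤ m) (hn : 1 ≤ n) (hg : g < m) :
    (T m n (List.replicate 2 0) g : ℚ)
      = ((m + n : ℕ) : ℚ) / ((m : ℚ) - g) * ((m - 1).choose g : ℚ)
          * (deMoivre n (m - g) : ℚ) := by
  rw [← Nat.cast_sub hg.le, T_zeros_eq_deMoivre hm hn 0 g, sum_eq_single (m - g)]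
  · rw [← remCount_eq_c, remCount_zero hm, if_pos (by omega)]
  · intro h _ hh
    rw [← remCount_eq_c, remCount_zero hm, if_neg (by omega), Nat.cast_zero, mul_zero, zero_mul]
  · intro h
    exact absurd (mem_Icc.2 (by omega)) h

end Strings

/-! ### Two deleted columns and strings of three zeros -/

section TwoColumns

theorem binom_natCast (a b : ℕ) : binom a b = a.choose b := by
  rw [binom]
  split_ifs with h
  · simp
  · rw [Nat.choose_eq_zero_of_lt (by omega), Nat.cast_zero]

theorem binom_eq_zero {a b : ℤ} (h : b < 0 ∨ a < b) : binom a b = 0 := by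
  rw [binom, if_neg (by omega)]

/-- Subset-of-a-subset identity; the integer convention makes it hold without restrictions, both
sides being 0 unless `l ≤ k ≤ n`. -/
theorem choose_mul_binom_sub (n k l : ℕ) :
    (n.choose l : ℚ) * binom ((n : ℤ) - l) ((k : ℤ) - l) = n.choose k * k.choose l := by
  by_cases h : l ≤ k ∧ k ≤ n
  · rw [← Nat.cast_sub h.1, ← Nat.cast_sub (h.1.trans h.2), binom_natCast]
    exact_mod_cast (Nat.choose_mul h.1).symm
  · rw [binom_eq_zero (by omega), mul_zero, eq_comm, mul_eq_zero, Nat.cast_eq_zero,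
      Nat.cast_eq_zero]
    by_cases hk : k ≤ n
    · exact Or.inr (Nat.choose_eq_zero_of_lt (by omega))
    · exact Or.inl (Nat.choose_eq_zero_of_lt (by omega))

/-- The sum condition forces the only entry to be `i - j - g`; the case split keeps truncated
subtraction from producing a false entry. -/
theorem chainSum_one (i g j k : ℕ) :
    chainSum 1 i g j k
      = if j + g ≤ i then j.choose (i - j - g) * (i - j - g).choose k else 0 := by
  rw [show (1 : ℕ) = 0 + 1 from rfl, chainSum_succ]
  simp only [chainSum_zero]
  by_cases h : j + g ≤ i
  · rw [if_pos h, if_pos (by omega), sum_eq_single (i - j - g)]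
    · rw [if_pos (by omega)]
    · intro f _ hf
      rw [if_neg (by omega), mul_zero]
    · intro hf
      rw [Nat.choose_eq_zero_of_lt (by rw [mem_range] at hf; omega), zero_mul]
  · rw [if_neg h, ite_eq_right_iff]
    intro _
    refine sum_eq_zero fun f _ => ?_
    rw [if_neg (by omega), mul_zero]

theorem c_one_of_add_le {m g h : ℕ} (hg : g ≠ 0) (hm : h + g ≤ m) :
    c 1 m g h = 1 / (g : ℚ) * ∑ l ∈ Icc 1 g,
      (l : ℚ) * (h.choose (m - h - g) * (m - h - g).choose l) * (g.choose l : ℚ) := by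
  rw [c_eq_of_ne_zero hg]
  simp only [chainSum_one, if_pos hm, Nat.cast_mul]

theorem c_one_of_lt {m g h : ℕ} (hg : g ≠ 0) (hm : m < h + g) : c 1 m g h = 0 := by
  rw [c_eq_of_ne_zero hg]
  simp [chainSum_one, if_neg hm.not_ge]

theorem c_one_zero (m h : ℕ) : c 1 m 0 h = binom h ((m : ℤ) - h) := by
  rw [c_zero_eq, chainSum_one]
  split_ifs with hm
  · rw [add_zero] at hm
    rw [← Nat.cast_sub hm, binom_natCast, Nat.sub_zero, Nat.choose_zero_right, mul_one]
  · rw [binom_eq_zero (by omega), Nat.cast_zero]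

theorem c_one_eq_cPrime (m g h : ℕ) : c 1 m g h = cPrime m g h := by
  rcases eq_or_ne g 0 with rfl | hg
  · rw [c_one_zero, cPrime, if_pos rfl]
    split_ifs with hm
    · rfl
    · exact binom_eq_zero (by omega)
  · rw [cPrime, if_neg hg]
    rcases lt_or_ge m (h + g) with hm | hm
    · rw [c_one_of_lt hg hm, sum_eq_zero, mul_zero]
      intro l _
      rw [binom_eq_zero (b := (m : ℤ) - g - h - l) (by omega), mul_zero]
    · rw [c_one_of_add_le hg hm]
      congr 1
      have hcast : (m : ℤ) - g - h = (m - h - g : ℕ) := by omega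
      rw [hcast]
      generalize m - h - g = e
      have hterm (l : ℕ) : (l : ℚ) * (h.choose l : ℚ) * (g.choose l : ℚ)
            * binom ((h : ℤ) - l) ((e : ℤ) - l)
          = l * (h.choose e * e.choose l) * g.choose l := by
        rw [← choose_mul_binom_sub]
        ring
      -- The ranges differ only in zero terms: `l = 0` by the factor `l`, `l > h` by `C(h, l)`, `l >
      -- e` by `C(e, l)`.
      rw [sum_subset (range_mono (by omega : min h (min g e) + 1 ≤ g + 1)),
        sum_subset (fun a ha => mem_range.2 (by have := mem_Icc.1 ha; omega) :
          Icc 1 g ⊆ range (g + 1))]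
      · exact sum_congr rfl fun l _ => (hterm l).symm
      · intro l hl hl'
        have : l = 0 := by
          simp only [mem_range, mem_Icc] at hl hl'
          omega
        simp [this]
      · intro l hl hl'
        simp only [mem_range] at hl hl'
        rcases lt_or_ge h l with h1 | h1
        · simp [Nat.choose_eq_zero_of_lt h1]
        · rw [hterm, Nat.choose_eq_zero_of_lt (by omega : e < l)]
          simp

theorem T_three_zeros {m n g : ℕ} (hm : 1 ≤ m) (hn : 1 ≤ n) (hg : g ≠ 0) :
    (T m n [0, 0, 0] g : ℚ)
      = ((m + n : ℕ) : ℚ) / ((n : ℚ) * g)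
          * ∑ h ∈ Icc 1 m, ∑ l ∈ Icc 1 g,
              (l : ℚ) * (n.choose l : ℚ) * (g.choose l : ℚ)
                * binom ((n : ℤ) - l) ((m : ℤ) - h - g - l)
                * binom ((n : ℤ) - m + h + g) (2 * (h : ℤ) + g - m) := by
  have := T_zeros_eq_choose hm hn 1 g
  simp only [List.replicate] at this
  rw [this, div_mul_eq_div_div, div_eq_mul_one_div (_ / _) (g : ℚ), mul_assoc]
  congr 1
  rw [mul_sum]
  refine sum_congr rfl fun h _ => ?_
  rcases lt_or_ge m (h + g) with hm | hm
  · rw [c_one_of_lt hg hm, zero_mul, sum_eq_zero, mul_zero]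
    intro l _
    rw [binom_eq_zero (b := (m : ℤ) - h - g - l) (by omega), mul_zero, zero_mul]
  · rw [c_one_of_add_le hg hm, mul_assoc, sum_mul]
    congr 1
    refine sum_congr rfl fun l _ => ?_
    obtain ⟨e, rfl⟩ := Nat.exists_eq_add_of_le hm
    rw [show h + g + e - h - g = e by omega,
      show ((h + g + e : ℕ) : ℤ) - h - g - l = (e : ℤ) - l by push_cast; ring,
      show (n : ℤ) - (h + g + e : ℕ) + h + g = n - e by push_cast; ring,
      show 2 * (h : ℤ) + g - (h + g + e : ℕ) = h - e by push_cast; ring]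
    -- With `e = m - h - g`, two applications give `C(n, l) C(n-l, e-l) C(n-e, h-e) = C(n, h) C(h,
    -- e) C(e, l)`, after cancelling nothing: `C(n, e)` is only an intermediate factor.
    have h1 := choose_mul_binom_sub n e l
    have h2 := choose_mul_binom_sub n h e
    linear_combination (-(l : ℚ) * g.choose l * binom ((n : ℤ) - e) ((h : ℤ) - e)) * h1
      - ((l : ℚ) * g.choose l * e.choose l) * h2

theorem T_three_zeros_zero {m n : ℕ} (hm : 1 ≤ m) (hn : 1 ≤ n) :
    (T m n [0, 0, 0] 0 : ℚ)
      = ((m + n : ℕ) : ℚ) / (n : ℚ)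
          * ∑ h ∈ Icc 1 m, binom (h : ℤ) ((m : ℤ) - h) * (n.choose h : ℚ) := by
  simp only [← c_one_zero]
  exact T_zeros_eq_choose hm hn 1 0

theorem T_three_zeros_zero' {m n : ℕ} (hm : 1 ≤ m) (hn : 1 ≤ n) :
    (T m n [0, 0, 0] 0 : ℚ)
      = ((m + n : ℕ) : ℚ) / (n : ℚ)
          * ∑ h ∈ Icc 1 m, binom (n : ℤ) ((m : ℤ) - h)
              * binom ((n : ℤ) - m + h) (2 * (h : ℤ) - m) := by
  rw [T_three_zeros_zero hm hn]
  congr 1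
  refine sum_congr rfl fun h hh => ?_
  obtain ⟨e, rfl⟩ := Nat.exists_eq_add_of_le (mem_Icc.1 hh).2
  rw [show ((h + e : ℕ) : ℤ) - h = (e : ℕ) by push_cast; ring,
    show (n : ℤ) - (h + e : ℕ) + h = n - e by push_cast; ring,
    show 2 * (h : ℤ) - (h + e : ℕ) = h - e by push_cast; ring, binom_natCast, binom_natCast,
    choose_mul_binom_sub, mul_comm]

end TwoColumns

end Auxiliary

end BinSeq

theorem mainTheorem10 :
    -- after deletion of `s + 1` columns: the number of remaining tableaux of each weight
    (∀ s m g h : ℕ, (BinSeq.remCount s m g h : ℚ) = BinSeq.c s m g h) ∧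
    -- the weights that occur
    (∀ s m h g : ℕ, 1 ≤ h → h ≤ m →
      ((∃ p : Composition m, p.length = h ∧ BinSeq.remWeight (s + 1) p = g) ↔
        max 0 ((m : ℤ) - (s + 1) * h) ≤ g ∧ (g : ℤ) ≤ max 0 ((m : ℤ) - h - s))) ∧
    -- one deleted column: the count over all heights, and the count at a fixed height
    (∀ m g : ℕ, 1 ≤ m →
      (Finset.univ.filter fun p : Composition m => BinSeq.remWeight 1 p = g).card
        = Nat.choose (m - 1) g ∧
      ∀ h : ℕ, BinSeq.remCount 0 m g h = if h + g = m then Nat.choose (m - 1) g else 0) ∧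
    -- strings of two equal digits
    (∀ m n g : ℕ, 1 ≤ m → 1 ≤ n →
      (g < m → (BinSeq.T m n (List.replicate 2 0) g : ℚ)
        = ((m + n : ℕ) : ℚ) / ((m : ℚ) - g) * (Nat.choose (m - 1) g : ℚ)
            * (BinSeq.deMoivre n (m - g) : ℚ)) ∧
      (g < n → (BinSeq.T m n (List.replicate 2 1) g : ℚ)
        = ((m + n : ℕ) : ℚ) / ((n : ℚ) - g) * (Nat.choose (n - 1) g : ℚ)
            * (BinSeq.deMoivre m (n - g) : ℚ))) ∧
    -- strings of `s + 2` zeros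
    (∀ s m n g : ℕ, 1 ≤ m → 1 ≤ n →
      (BinSeq.T m n (List.replicate (s + 2) 0) g : ℚ)
        = ∑ h ∈ Finset.Icc 1 m, ((m + n : ℕ) : ℚ) / (h : ℚ) * BinSeq.c s m g h
            * (BinSeq.deMoivre n h : ℚ) ∧
      (BinSeq.T m n (List.replicate (s + 2) 0) g : ℚ)
        = ((m + n : ℕ) : ℚ) / (n : ℚ)
            * ∑ h ∈ Finset.Icc 1 m, BinSeq.c s m g h * (Nat.choose n h : ℚ)) ∧
    -- strings of `s + 2` ones
    (∀ s m n g : ℕ, 1 ≤ m → 1 ≤ n →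
      (BinSeq.T m n (List.replicate (s + 2) 1) g : ℚ)
        = ∑ h ∈ Finset.Icc 1 n, ((m + n : ℕ) : ℚ) / (h : ℚ) * BinSeq.c s n g h
            * (BinSeq.deMoivre m h : ℚ) ∧
      (BinSeq.T m n (List.replicate (s + 2) 1) g : ℚ)
        = ((m + n : ℕ) : ℚ) / (m : ℚ)
            * ∑ h ∈ Finset.Icc 1 n, BinSeq.c s n g h * (Nat.choose m h : ℚ)) ∧
    -- two deleted columns: the explicit coefficients
    (∀ m g h : ℕ, BinSeq.c 1 m g h = BinSeq.cPrime m g h) ∧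
    -- strings of three zeros
    (∀ m n g : ℕ, 1 ≤ m → 1 ≤ n →
      (BinSeq.T m n [0, 0, 0] g : ℚ)
        = ∑ h ∈ Finset.Icc 1 m, ((m + n : ℕ) : ℚ) / (h : ℚ) * BinSeq.cPrime m g h
            * (BinSeq.deMoivre n h : ℚ) ∧
      (BinSeq.T m n [0, 0, 0] g : ℚ)
        = ((m + n : ℕ) : ℚ) / (n : ℚ)
            * ∑ h ∈ Finset.Icc 1 m, BinSeq.cPrime m g h * (Nat.choose n h : ℚ)) ∧
    (∀ m n g : ℕ, 1 ≤ m → 1 ≤ n → 1 ≤ g →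
      (BinSeq.T m n [0, 0, 0] g : ℚ)
        = ((m + n : ℕ) : ℚ) / ((n : ℚ) * g)
            * ∑ h ∈ Finset.Icc 1 m, ∑ l ∈ Finset.Icc 1 g,
                (l : ℚ) * (Nat.choose n l : ℚ) * (Nat.choose g l : ℚ)
                  * BinSeq.binom ((n : ℤ) - l) ((m : ℤ) - h - g - l)
                  * BinSeq.binom ((n : ℤ) - m + h + g) (2 * (h : ℤ) + g - m)) ∧
    (∀ m n : ℕ, 1 ≤ m → 1 ≤ n →
      (BinSeq.T m n [0, 0, 0] 0 : ℚ)
        = ((m + n : ℕ) : ℚ) / (n : ℚ)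
            * ∑ h ∈ Finset.Icc 1 m,
                BinSeq.binom (h : ℤ) ((m : ℤ) - h) * (Nat.choose n h : ℚ) ∧
      (BinSeq.T m n [0, 0, 0] 0 : ℚ)
        = ((m + n : ℕ) : ℚ) / (n : ℚ)
            * ∑ h ∈ Finset.Icc 1 m,
                BinSeq.binom (n : ℤ) ((m : ℤ) - h)
                  * BinSeq.binom ((n : ℤ) - m + h) (2 * (h : ℤ) - m)) := by
  refine ⟨BinSeq.remCount_eq_c, fun s m h g => BinSeq.exists_remWeight_iff,
    fun m g hm => ⟨BinSeq.card_remWeight_one hm g, BinSeq.remCount_zero hm g⟩,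
    fun m n g hm hn => ⟨BinSeq.T_two_zeros hm hn, fun hg => ?_⟩,
    fun s m n g hm hn =>
      ⟨BinSeq.T_zeros_eq_deMoivre hm hn s g, BinSeq.T_zeros_eq_choose hm hn s g⟩,
    fun s m n g hm hn => ?_, BinSeq.c_one_eq_cPrime, fun m n g hm hn => ?_,
    fun m n g hm hn hg => BinSeq.T_three_zeros hm hn (Nat.one_le_iff_ne_zero.1 hg),
    fun m n hm hn => ⟨BinSeq.T_three_zeros_zero hm hn, BinSeq.T_three_zeros_zero' hm hn⟩⟩
  · rw [BinSeq.T_ones, add_comm m n]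
    exact BinSeq.T_two_zeros hn hm hg
  · rw [BinSeq.T_ones, add_comm m n]
    exact ⟨BinSeq.T_zeros_eq_deMoivre hn hm s g, BinSeq.T_zeros_eq_choose hn hm s g⟩
  · simp only [← BinSeq.c_one_eq_cPrime]
    exact ⟨BinSeq.T_zeros_eq_deMoivre hm hn 1 g, BinSeq.T_zeros_eq_choose hm hn 1 g⟩
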